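/- Let $\mathbb{M}$ be the second-order theory of equality. Its objects are the finite sequences of natural numbers. A morphism $(m_1,\dots,m_k)\to(n_1,\dots,n_l)$ is a tuple $\langle t_1,\dots,t_l\rangle$ of elementary second-order terms $\mathsf{m}_1:[m_1],\dots,\mathsf{m}_k:[m_k]\vartriangleright x_1,\dots,x_{n_i}\vdash t_i$, that is, terms built only from the variables $x_j$ and from the metavariables $\mathsf{m}_p$, each applied to $m_p$ terms. Composition is metasubstitution. In $\mathbb{M}$ the empty sequence is terminal, concatenation is the product, and $(0)$ is exponentiable, with $(0)\Rightarrow(m_1,\dots,m_k)=(m_1+1,\dots,m_k+1)$. A second-order algebraic theory is a small cartesian category $\mathcal{M}$ (i.e. one with finite products) together with an identity-on-objects functor $M:\mathbb{M}\to\mathcal{M}$ which strictly preserves the finite products and preserves the exponentiable object $(0)$ (the images of the evaluation maps $((0)\Rightarrow X)\times(0)\to X$ exhibit exponentials in $\mathcal{M}$). A second-order algebraic translation from $M:\mathbb{M}\to\mathcal{M}$ to $M':\mathbb{M}\to\mathcal{M}'$ is a finite-product-preserving functor $F:\mathcal{M}\to\mathcal{M}'$ with $F\circ M=M'$. Let $\mathbf{FMod}(M)$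 be the category of finite-product-preserving functors $\mathcal{M}\to\mathbf{Set}$ and all natural transformations between them. Theorem 8.3. For every second-order algebraic translation $F:M\to M'$ of second-order algebraic theories, the functor $\mathbf{FMod}(F):\mathbf{FMod}(M')\to\mathbf{FMod}(M)$, $S\mapsto S\circ F$, has a left adjoint, and the resulting adjunction is monadic: the comparison functor from $\mathbf{FMod}(M')$ to the category of Eilenberg–Moore algebras of the induced monad on $\mathbf{FMod}(M)$ is an equivalence of categories. -/

import Mathlib

open CategoryTheory CategoryTheory.Limits

universe u

namespace SecondOrder

/-! ### Elementary second-order terms -/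

/-- `MetaVar Θ m`: the metavariables of meta-arity `m` declared in the metavariable context
`Θ = (m₁, …, m_k)`, i.e. the positions of `Θ` holding the number `m`. -/
inductive MetaVar : List ℕ → ℕ → Type
  | zero {Θ : List ℕ} {m : ℕ} : MetaVar (m :: Θ) m
  | succ {Θ : List ℕ} {m k : ℕ} (v : MetaVar Θ m) : MetaVar (k :: Θ) m

/-- Inclusion of the metavariables of `Θ` in those of the concatenation `Θ ++ Ξ`. -/
def MetaVar.inl : {Θ : List ℕ} → (Ξ : List ℕ) → {m : ℕ} → MetaVar Θ m → MetaVar (Θ ++ Ξ) m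
  | _ :: _, _, _, .zero => .zero
  | _ :: _, Ξ, _, .succ v => .succ (v.inl Ξ)

/-- Inclusion of the metavariables of `Ξ` in those of the concatenation `Θ ++ Ξ`. -/
def MetaVar.inr : (Θ : List ℕ) → {Ξ : List ℕ} → {m : ℕ} → MetaVar Ξ m → MetaVar (Θ ++ Ξ) m
  | [], _, _, v => v
  | _ :: Θ, _, _, v => .succ (MetaVar.inr Θ v)

/-- The metavariable of `(m₁ + 1, …, m_k + 1)` at the same position as a given metavariable
of `(m₁, …, m_k)`. -/
def MetaVar.up : {Θ : List ℕ} → {m : ℕ} → MetaVar Θ m → MetaVar (Θ.map (· + 1)) (m + 1)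
  | _ :: _, _, .zero => .zero
  | _ :: _, _, .succ v => .succ v.up

/-- Elementary second-order terms `Θ ▹ x₁, …, xₙ ⊢ t` (terms over the empty second-order
signature): variables, and metavariables parameterised by as many terms as their arity. -/
inductive ETerm (Θ : List ℕ) (n : ℕ) : Type
  | var (i : Fin n) : ETerm Θ n
  | app {m : ℕ} (M : MetaVar Θ m) (args : Fin m → ETerm Θ n) : ETerm Θ n

/-- Simultaneous substitution `t {xᵢ := σ i}` of terms for variables. -/
def ETerm.subst {Θ : List ℕ} {n k : ℕ} (σ : Fin n → ETerm Θ k) : ETerm Θ n → ETerm Θ k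
  | .var i => σ i
  | .app M args => .app M fun j => (args j).subst σ

/-- Metasubstitution `t {𝗆 := (x₁, …, x_m) s 𝗆}` of abstracted terms for metavariables. -/
def ETerm.msubst {Θ Ξ : List ℕ} {n : ℕ} (s : ∀ m, MetaVar Θ m → ETerm Ξ m) :
    ETerm Θ n → ETerm Ξ n
  | .var i => .var i
  | .app M args => (s _ M).subst fun j => (args j).msubst s

theorem ETerm.subst_var {Θ : List ℕ} {n : ℕ} (t : ETerm Θ n) : t.subst ETerm.var = t := by
  induction t with
  | var i => rfl
  | app M args ih => simp only [ETerm.subst, ih]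

theorem ETerm.subst_subst {Θ : List ℕ} {n k l : ℕ} (σ : Fin n → ETerm Θ k)
    (τ : Fin k → ETerm Θ l) (t : ETerm Θ n) :
    (t.subst σ).subst τ = t.subst fun i => (σ i).subst τ := by
  induction t with
  | var i => rfl
  | app M args ih => simp only [ETerm.subst, ih]

theorem ETerm.msubst_subst {Θ Ξ : List ℕ} {n k : ℕ} (s : ∀ m, MetaVar Θ m → ETerm Ξ m)
    (σ : Fin n → ETerm Θ k) (t : ETerm Θ n) :
    (t.subst σ).msubst s = (t.msubst s).subst fun i => (σ i).msubst s := by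
  induction t with
  | var i => rfl
  | app M args ih => simp only [ETerm.subst, ETerm.msubst, ih, ETerm.subst_subst]

theorem ETerm.msubst_id {Θ : List ℕ} {n : ℕ} (t : ETerm Θ n) :
    t.msubst (fun _ M => .app M .var) = t := by
  induction t with
  | var i => rfl
  | app M args ih => simp only [ETerm.msubst, ETerm.subst, ih]

theorem ETerm.msubst_msubst {Θ Ξ Ψ : List ℕ} {n : ℕ} (s : ∀ m, MetaVar Θ m → ETerm Ξ m)
    (r : ∀ m, MetaVar Ξ m → ETerm Ψ m) (t : ETerm Θ n) :
    (t.msubst s).msubst r = t.msubst fun m M => (s m M).msubst r := by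
  induction t with
  | var i => rfl
  | app M args ih => simp only [ETerm.msubst, ETerm.msubst_subst, ih]

/-! ### The second-order theory of equality -/

/-- Objects of the second-order theory of equality `𝕄`: finite sequences of natural numbers. -/
structure EqCat : Type where
  /-- the underlying sequence -/
  ctx : List ℕ

/-- A morphism `(m₁, …, m_k) ⟶ (n₁, …, n_l)` of `𝕄` is a tuple `⟨t₁, …, t_l⟩` of elementary terms
`𝗆₁ : [m₁], …, 𝗆_k : [m_k] ▹ x₁, …, x_{nᵢ} ⊢ tᵢ`; composition is metasubstitution. -/
instance EqCat.category : Category.{0} EqCat where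
  Hom X Y := ∀ m, MetaVar Y.ctx m → ETerm X.ctx m
  id _ := fun _ M => .app M .var
  comp s t := fun m M => (t m M).msubst s
  id_comp t := by funext m M; exact ETerm.msubst_id _
  comp_id t := by funext m M; exact ETerm.subst_var _
  assoc s t r := by funext m M; exact (ETerm.msubst_msubst _ _ _).symm

namespace EqCat

/-- The empty sequence, the terminal object of `𝕄`. -/
def nil : EqCat := ⟨[]⟩

/-- The exponentiable object `(0)` of `𝕄`. -/
def zero : EqCat := ⟨[0]⟩

/-- Concatenation of sequences, the product in `𝕄`. -/
def prod (X Y : EqCat) : EqCat := ⟨X.ctx ++ Y.ctx⟩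

/-- The first projection `⟨𝗆ᵢ[x₁, …, x_{mᵢ}]⟩ᵢ : X × Y ⟶ X`. -/
def fst (X Y : EqCat) : X.prod Y ⟶ X := fun _ M => .app (M.inl Y.ctx) .var

/-- The second projection `X × Y ⟶ Y`. -/
def snd (X Y : EqCat) : X.prod Y ⟶ Y := fun _ M => .app (MetaVar.inr X.ctx M) .var

/-- The exponential `(0) ⇒ (m₁, …, m_k) = (m₁ + 1, …, m_k + 1)` of `𝕄`. -/
def exp (X : EqCat) : EqCat := ⟨X.ctx.map (· + 1)⟩

/-- The evaluation map `⟨𝗆ᵢ[x₁, …, x_{mᵢ}, 𝗇[]]⟩ᵢ : (m₁ + 1, …, m_k + 1) × (0) ⟶ (m₁, …, m_k)`. -/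
def ev (X : EqCat) : X.exp.prod zero ⟶ X := fun m M =>
  .app (M.up.inl [0])
    (Fin.snoc (α := fun _ => ETerm (X.ctx.map (· + 1) ++ [0]) m) .var
      (.app (MetaVar.inr (X.ctx.map (· + 1)) .zero) Fin.elim0))

end EqCat

/-! ### Second-order algebraic theories and their translations -/

/-- For a cone `c` exhibiting `E × A`, the morphism `ev : E × A ⟶ B` is the evaluation of an
exponential `A ⇒ B`: for every product `d = Z × A` and every `f : Z × A ⟶ B` there is a
unique `g : Z ⟶ E` with `ev ∘ (g × A) = f`. Here `h` is the morphism `g × A`. -/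
def IsExponential {C : Type*} [Category C] {A B E : C} (c : BinaryFan E A) (ev : c.pt ⟶ B) :
    Prop :=
  Nonempty (IsLimit c) ∧
    ∀ (Z : C) (d : BinaryFan Z A), IsLimit d → ∀ f : d.pt ⟶ B,
      ∃! g : Z ⟶ E, ∃ h : d.pt ⟶ c.pt, h ≫ c.fst = d.fst ≫ g ∧ h ≫ c.snd = d.snd ∧ h ≫ ev = f

/-- A small category on the objects of `𝕄` with an identity-on-objects functor from `𝕄`. -/
structure PreTheory : Type (u + 1) where
  /-- morphisms -/
  Hom : List ℕ → List ℕ → Type u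
  /-- identities -/
  id : ∀ X, Hom X X
  /-- composition, in diagrammatic order -/
  comp : ∀ {X Y Z}, Hom X Y → Hom Y Z → Hom X Z
  id_comp : ∀ {X Y} (f : Hom X Y), comp (id X) f = f
  comp_id : ∀ {X Y} (f : Hom X Y), comp f (id Y) = f
  assoc : ∀ {W X Y Z} (f : Hom W X) (g : Hom X Y) (h : Hom Y Z),
    comp (comp f g) h = comp f (comp g h)
  /-- the action on morphisms of the functor from `𝕄` -/
  map : ∀ {X Y : EqCat}, (X ⟶ Y) → Hom X.ctx Y.ctx
  map_id : ∀ X : EqCat, map (𝟙 X) = id X.ctx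
  map_comp : ∀ {X Y Z : EqCat} (f : X ⟶ Y) (g : Y ⟶ Z), map (f ≫ g) = comp (map f) (map g)

/-- The objects of the category underlying a pre-theory. -/
structure PreTheory.Obj (P : PreTheory.{u}) : Type where
  /-- the underlying sequence -/
  ctx : List ℕ

instance PreTheory.category (P : PreTheory.{u}) : Category.{u} P.Obj where
  Hom X Y := P.Hom X.ctx Y.ctx
  id X := P.id X.ctx
  comp f g := P.comp f g
  id_comp := P.id_comp
  comp_id := P.comp_id
  assoc := P.assoc

/-- The identity-on-objects functor from `𝕄`. -/
def PreTheory.functor (P : PreTheory.{u}) : EqCat ⥤ P.Obj where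
  obj X := ⟨X.ctx⟩
  map f := P.map f
  map_id := P.map_id
  map_comp := P.map_comp

/-- A second-order algebraic theory `M : 𝕄 ⟶ 𝓜`: the functor `M` is the identity on objects, the
small category `𝓜` is cartesian with `M` strictly preserving the chosen terminal object and
products, and `M` preserves the exponentiable object `(0)`. -/
structure Theory : Type (u + 1) extends PreTheory.{u} where
  terminal : Nonempty (IsTerminal (toPreTheory.functor.obj EqCat.nil))
  product : ∀ X Y : EqCat, Nonempty (IsLimit (BinaryFan.mk
    (toPreTheory.functor.map (EqCat.fst X Y)) (toPreTheory.functor.map (EqCat.snd X Y))))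
  exponential : ∀ X : EqCat, IsExponential
    (BinaryFan.mk (toPreTheory.functor.map (EqCat.fst X.exp EqCat.zero))
      (toPreTheory.functor.map (EqCat.snd X.exp EqCat.zero)))
    (toPreTheory.functor.map (EqCat.ev X))

/-- The underlying small cartesian category of a theory. -/
abbrev Theory.Cat (T : Theory.{u}) : Type := T.toPreTheory.Obj

/-- A second-order algebraic translation `M ⟶ M'`: a cartesian functor `F : 𝓜 ⥤ 𝓜'` such that
`F ∘ M = M'`. -/
structure Translation (T T' : Theory.{u}) : Type u where
  functor : T.Cat ⥤ T'.Cat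
  cartesian : PreservesFiniteProducts functor
  comm : T.toPreTheory.functor ⋙ functor = T'.toPreTheory.functor

/-! ### Functorial models and algebraic functors -/

/-- The property of a functor `𝓜 ⥤ Set` of being a model, i.e. cartesian. -/
def Theory.isModel (T : Theory.{u}) : ObjectProperty (T.Cat ⥤ Type u) :=
  fun G => PreservesFiniteProducts G

/-- The category `FMod(M)` of set-theoretic functorial models, with all natural transformations
as morphisms. -/
abbrev Theory.FMod (T : Theory.{u}) : Type (u + 1) := T.isModel.FullSubcategory

/-- The algebraic functor `FMod(F) : FMod(M') ⥤ FMod(M)`, `S ↦ S ∘ F`. -/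
def Translation.algebraicFunctor {T T' : Theory.{u}} (F : Translation T T') :
    T'.FMod ⥤ T.FMod :=
  T.isModel.lift
    (T'.isModel.ι ⋙ (Functor.whiskeringLeft T.Cat T'.Cat (Type u)).obj F.functor)
    (fun S => by
      have : PreservesFiniteProducts F.functor := F.cartesian
      have : PreservesFiniteProducts S.obj := S.property
      exact comp_preservesFiniteProducts F.functor S.obj)

end SecondOrder

/-! Finite-product-preserving functors to sets are closed under sifted colimits, because these
commute with finite products in sets (`preservesFiniteProducts_colimit_of_isSifted`). Two sifted
shapes matter. The opposite of the category of elements of a model is sifted, so each model is a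
sifted colimit of corepresentables. The left adjoint must send the corepresentable at `c` to the one
at `F c`, and it extends along these colimits (`isRightAdjoint_restrict`). The walking reflexive
pair is sifted too, so reflexive coequalizers of models are computed objectwise and restriction
preserves them. Restriction reflects isomorphisms because a translation is essentially surjective,
and the reflexive monadicity theorem applies (`isEquivalence_comparison_restrict`). -/

namespace CategoryTheory

open Opposite

/-! ### Sifted colimits of product-preserving functors -/

section Sifted

variable {C : Type*} [Category* C]

/-- A sifted colimit of finite-product-preserving set-valued functors preserves finite products. -/
lemma preservesFiniteProducts_colimit_of_isSifted {J : Type u} [SmallCategory J] [IsSifted J]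
    (K : J ⥤ C ⥤ Type u) (hK : ∀ j, PreservesFiniteProducts (K.obj j)) :
    PreservesFiniteProducts (colimit K) := by
  have hflip : PreservesFiniteProducts K.flip := ⟨fun n =>
    preservesLimitsOfShape_of_evaluation _ _ fun j =>
      (hK j).preserves n⟩
  have := comp_preservesFiniteProducts K.flip (colim : (J ⥤ Type u) ⥤ Type u)
  exact ⟨fun n => preservesLimitsOfShape_of_natIso (colimitIsoFlipCompColim K).symm⟩

/-- Finite-product-preserving functors to sets. -/
abbrev preservesFiniteProductsProperty (C : Type*) [Category* C] :
    ObjectProperty (C ⥤ Type u) :=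
  fun G => PreservesFiniteProducts G

instance : (preservesFiniteProductsProperty.{u} C).IsClosedUnderIsomorphisms where
  of_iso e h := ⟨fun _ =>
    have : PreservesFiniteProducts _ := h
    preservesLimitsOfShape_of_natIso e⟩

instance isClosedUnderColimitsOfShape_of_isSifted {J : Type u} [SmallCategory J] [IsSifted J] :
    (preservesFiniteProductsProperty.{u} C).IsClosedUnderColimitsOfShape J :=
  .mk' (by
    rintro _ ⟨K, hK⟩
    exact preservesFiniteProducts_colimit_of_isSifted K hK)

namespace Limits.WalkingReflexivePair

/-- An object of the comma category of the diagonal, lying over `zero`. -/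
abbrev zeroArrow {a b : WalkingReflexivePair} (x : a ⟶ zero) (y : b ⟶ zero) :
    StructuredArrow (a, b) (Functor.diag WalkingReflexivePair) :=
  StructuredArrow.mk (Y := zero) (show (a, b) ⟶ (Functor.diag _).obj zero from (x, y))

/-- An object of the comma category of the diagonal, lying over `one`. -/
abbrev oneArrow {a b : WalkingReflexivePair} (x : a ⟶ one) (y : b ⟶ one) :
    StructuredArrow (a, b) (Functor.diag WalkingReflexivePair) :=
  StructuredArrow.mk (Y := one) (show (a, b) ⟶ (Functor.diag _).obj one from (x, y))

lemma zigzag_left {a b : WalkingReflexivePair} (x : a ⟶ one) (y : b ⟶ one) :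
    Zigzag (oneArrow x y) (zeroArrow (x ≫ Hom.left) (y ≫ Hom.left)) :=
  .of_hom (StructuredArrow.homMk Hom.left rfl)

lemma zigzag_left_right {a b : WalkingReflexivePair} (x : a ⟶ one) (y : b ⟶ one) :
    Zigzag (zeroArrow (x ≫ Hom.left) (y ≫ Hom.left))
      (zeroArrow (x ≫ Hom.right) (y ≫ Hom.right)) :=
  (zigzag_left x y).symm.trans (.of_hom (StructuredArrow.homMk Hom.right rfl))

-- The two coordinates are changed one at a time, the other being held fixed by a degenerate arrow.
lemma zigzag_zeroArrow {a b : WalkingReflexivePair} (x x' : a ⟶ zero) (y y' : b ⟶ zero) :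
    Zigzag (zeroArrow x y) (zeroArrow x' y') := by
  have h₁ (x x' : a ⟶ zero) (y : b ⟶ zero) : Zigzag (zeroArrow x y) (zeroArrow x' y) := by
    -- `reflexion` is a common section of `left` and `right`, so `y ≫ reflexion` returns to `y`
    -- under both, while `𝟙` becomes `left` and `right`. Only `a = one` needs this: the sole
    -- endomorphism of `zero` is the identity.
    have key := zigzag_left_right (a := one) (𝟙 _) (y ≫ Hom.reflexion)
    simp only [Category.assoc, reflexion_comp_left, reflexion_comp_right, Category.id_comp,
      Category.comp_id] at key
    obtain (_ | _) := x <;> obtain (_ | _) := x' <;> first | rfl | exact key | exact key.symm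
  have h₂ (x : a ⟶ zero) (y y' : b ⟶ zero) : Zigzag (zeroArrow x y) (zeroArrow x y') := by
    have key := zigzag_left_right (b := one) (x ≫ Hom.reflexion) (𝟙 _)
    simp only [Category.assoc, reflexion_comp_left, reflexion_comp_right, Category.id_comp,
      Category.comp_id] at key
    obtain (_ | _) := y <;> obtain (_ | _) := y' <;> first | rfl | exact key | exact key.symm
  exact (h₁ x x' y).trans (h₂ x' y y')

instance isSifted : IsSifted WalkingReflexivePair where
  nonempty := ⟨zero⟩
  out := by
    rintro ⟨a, b⟩
    have hz : ∀ a : WalkingReflexivePair, Nonempty (a ⟶ zero) := by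
      rintro (_ | _)
      exacts [⟨𝟙 _⟩, ⟨Hom.left⟩]
    obtain ⟨x₀⟩ := hz a
    obtain ⟨y₀⟩ := hz b
    have : Nonempty (StructuredArrow (a, b) (Functor.diag WalkingReflexivePair)) :=
      ⟨zeroArrow x₀ y₀⟩
    have toBase (j : StructuredArrow (a, b) (Functor.diag WalkingReflexivePair)) :
        Zigzag j (zeroArrow x₀ y₀) := by
      obtain ⟨⟨⟨⟩⟩, c, x, y⟩ := j
      cases c with
      | zero => exact zigzag_zeroArrow x x₀ y y₀
      | one => exact (zigzag_left x y).trans (zigzag_zeroArrow _ _ _ _)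
    exact zigzag_isConnected fun i j => (toBase i).trans (toBase j).symm

end Limits.WalkingReflexivePair

/-- Passing to `AsSmall` moves the shape into universe `u`, where the closure result for sifted
shapes is stated. -/
instance isClosedUnderColimitsOfShape_walkingReflexivePair :
    (preservesFiniteProductsProperty.{u} C).IsClosedUnderColimitsOfShape WalkingReflexivePair :=
  have : IsSifted (AsSmall.{u} WalkingReflexivePair) :=
    IsSifted.isSifted_iff_asSmallIsSifted.1 inferInstance
  .of_equivalence AsSmall.equiv.symm

end Sifted

/-! ### Adjointness and monadicity of restriction -/

section Restriction

variable {C D : Type} [Category.{u} C] [Category.{u} D]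

/-- Restriction of finite-product-preserving functors to sets along a functor preserving finite
products. -/
abbrev restrict (F : C ⥤ D) [PreservesFiniteProducts F] :
    (preservesFiniteProductsProperty.{u} D).FullSubcategory ⥤
      (preservesFiniteProductsProperty.{u} C).FullSubcategory :=
  (preservesFiniteProductsProperty.{u} C).lift
    ((preservesFiniteProductsProperty.{u} D).ι ⋙ (Functor.whiskeringLeft C D (Type u)).obj F)
    (fun S => by
      have : PreservesFiniteProducts S.obj := S.property
      exact comp_preservesFiniteProducts F S.obj)

/-- Closure makes the inclusion into all functors preserve these colimits, which are then objectwise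
and so stable under precomposition. -/
lemma preservesColimitsOfShape_restrict (F : C ⥤ D) [PreservesFiniteProducts F]
    (J : Type*) [Category* J] [HasColimitsOfShape J (Type u)]
    [(preservesFiniteProductsProperty.{u} D).IsClosedUnderColimitsOfShape J] :
    PreservesColimitsOfShape J (restrict F) := by
  have : PreservesColimitsOfShape J
      (restrict F ⋙ (preservesFiniteProductsProperty.{u} C).ι) :=
    inferInstanceAs (PreservesColimitsOfShape J
      ((preservesFiniteProductsProperty.{u} D).ι ⋙
        (Functor.whiskeringLeft C D (Type u)).obj F))
  exact preservesColimitsOfShape_of_reflects_of_preserves _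
    (preservesFiniteProductsProperty.{u} C).ι

lemma reflectsIsomorphisms_restrict (F : C ⥤ D) [PreservesFiniteProducts F] [F.EssSurj] :
    (restrict F).ReflectsIsomorphisms where
  reflects {S S'} f hf := by
    have h₁ : IsIso (((restrict F).map f).hom) :=
      inferInstanceAs (IsIso ((preservesFiniteProductsProperty.{u} C).ι.map ((restrict F).map f)))
    have h₂ (d : D) : IsIso (f.hom.app d) := by
      rw [← NatTrans.isIso_app_iff_of_iso f.hom (F.objObjPreimageIso d)]
      exact inferInstanceAs (IsIso (((restrict F).map f).hom.app (F.objPreimage d)))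
    have h₃ : IsIso ((preservesFiniteProductsProperty.{u} D).ι.map f) :=
      NatIso.isIso_of_isIso_app f.hom
    exact isIso_of_reflects_iso f (preservesFiniteProductsProperty.{u} D).ι

lemma preservesFiniteProducts_coyoneda (X : Cᵒᵖ) :
    preservesFiniteProductsProperty.{u} C (coyoneda.obj X) :=
  ⟨fun _ => inferInstance⟩

/-- The left adjoint of restriction is defined on corepresentables: it sends the functor
corepresented by `c` to the one corepresented by `F c`. -/
lemma leftAdjointObjIsDefined_coyoneda (F : C ⥤ D) [PreservesFiniteProducts F] (c : C)
    (hc : preservesFiniteProductsProperty.{u} C (coyoneda.obj (op c))) :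
    (restrict F).leftAdjointObjIsDefined ⟨coyoneda.obj (op c), hc⟩ :=
  Functor.CorepresentableBy.isCorepresentable
    (X := ⟨coyoneda.obj (op (F.obj c)), preservesFiniteProducts_coyoneda _⟩)
    { homEquiv {S} := (preservesFiniteProductsProperty.{u} D).fullyFaithfulι.homEquiv.trans
        ((show (coyoneda.obj (op (F.obj c)) ⟶ S.obj) ≃ (coyoneda.obj (op c) ⟶ F ⋙ S.obj) from
          coyonedaEquiv.trans (coyonedaEquiv (F := F ⋙ S.obj)).symm).trans
          ((preservesFiniteProductsProperty.{u} C).fullyFaithfulι.homEquiv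
            (X := ⟨coyoneda.obj (op c), hc⟩) (Y := (restrict F).obj S)).symm)
      homEquiv_comp g f := by
        apply (preservesFiniteProductsProperty.{u} C).ι.map_injective
        apply coyonedaEquiv.injective
        -- Both sides of the Yoneda correspondence are elements of `S (F c)`, so naturality is
        -- checked on that element.
        let e {S : D ⥤ Type u} (t : coyoneda.obj (op (F.obj c)) ⟶ S) :
            coyoneda.obj (op c) ⟶ F ⋙ S :=
          (coyonedaEquiv (F := F ⋙ S)).symm (coyonedaEquiv (X := F.obj c) (F := S) t)
        have he {S : D ⥤ Type u} (t : coyoneda.obj (op (F.obj c)) ⟶ S) :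
            coyonedaEquiv (F := F ⋙ S) (e t) = coyonedaEquiv (X := F.obj c) (F := S) t :=
          (coyonedaEquiv (X := c) (F := F ⋙ S)).apply_symm_apply _
        change coyonedaEquiv (e (f.hom ≫ g.hom)) =
          coyonedaEquiv (e f.hom ≫ Functor.whiskerLeft F g.hom)
        rw [coyonedaEquiv_comp, he, he]
        exact coyonedaEquiv_comp _ _ }

/-- The category of elements inherits finite products from `C`, so its opposite has finite
coproducts. -/
instance isSifted_elements_op [HasFiniteProducts C] (S : C ⥤ Type u)
    [PreservesFiniteProducts S] : IsSifted S.Elementsᵒᵖ := by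
  have : Nonempty S.Elementsᵒᵖ := ⟨op (⊤_ S.Elements)⟩
  infer_instance

/-- A set-valued functor as the colimit of corepresentables over its category of elements. -/
abbrev coyonedaDiagram (S : C ⥤ Type u) : S.Elementsᵒᵖ ⥤ C ⥤ Type u :=
  (CategoryOfElements.π S).op ⋙ coyoneda

/-- The tautological cocone exhibiting a set-valued functor over its diagram of corepresentables. -/
def coyonedaCocone (S : C ⥤ Type u) : Cocone (coyonedaDiagram S) where
  pt := S
  ι :=
    { app x := coyonedaEquiv.symm x.unop.2
      naturality x y f := by
        have h : S.map f.unop.1 y.unop.2 = x.unop.2 := f.unop.2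
        apply coyonedaEquiv.injective
        change coyonedaEquiv (coyoneda.map f.unop.1.op ≫ coyonedaEquiv.symm y.unop.2) =
          coyonedaEquiv (coyonedaEquiv.symm x.unop.2 ≫ 𝟙 S)
        rw [← coyonedaEquiv_naturality, Category.comp_id, Equiv.apply_symm_apply,
          Equiv.apply_symm_apply, h] }

/-- The tautological cocone is a colimit. -/
def coyonedaCoconeIsColimit (S : C ⥤ Type u) : IsColimit (coyonedaCocone S) where
  desc s :=
    { app c := ↾ fun x => coyonedaEquiv (s.ι.app (op ⟨c, x⟩))
      naturality c c' g := by
        ext (x : S.obj c)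
        have hw := s.w (CategoryOfElements.homMk (F := S) ⟨c, x⟩ ⟨c', S.map g x⟩ g rfl).op
        exact (congrArg coyonedaEquiv hw).symm.trans
          (coyonedaEquiv_naturality (s.ι.app (op ⟨c, x⟩)) g).symm }
  fac s x := by
    apply coyonedaEquiv.injective
    exact (coyonedaEquiv_comp (coyonedaEquiv.symm x.unop.2) _).trans
      (congrArg (fun z => coyonedaEquiv (s.ι.app (op ⟨x.unop.1, z⟩)))
        (Equiv.apply_symm_apply _ _))
  uniq s m hm := by
    ext c x
    change m.app c x = coyonedaEquiv (s.ι.app (op ⟨c, x⟩))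
    rw [← hm]
    change _ = coyonedaEquiv (coyonedaEquiv.symm x ≫ m)
    rw [coyonedaEquiv_comp, Equiv.apply_symm_apply]

theorem isRightAdjoint_restrict (F : C ⥤ D) [PreservesFiniteProducts F] [HasFiniteProducts C] :
    (restrict F).IsRightAdjoint := by
  apply Functor.isRightAdjoint_of_leftAdjointObjIsDefined_eq_top
  ext S
  have : PreservesFiniteProducts S.obj := S.property
  let R : S.obj.Elementsᵒᵖ ⥤ (preservesFiniteProductsProperty.{u} C).FullSubcategory :=
    (preservesFiniteProductsProperty.{u} C).lift (coyonedaDiagram S.obj)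
      fun _ => preservesFiniteProducts_coyoneda _
  let c : Cocone R :=
    { pt := S
      ι :=
        { app x := ObjectProperty.homMk ((coyonedaCocone S.obj).ι.app x)
          naturality x y f := by
            ext1
            exact (coyonedaCocone S.obj).ι.naturality f } }
  have hc : IsColimit c :=
    isColimitOfReflects (preservesFiniteProductsProperty.{u} C).ι
      (coyonedaCoconeIsColimit S.obj)
  -- Siftedness of the shape supplies the corresponding colimit of models of `D`, which is the value
  -- of the left adjoint at `S`.
  exact iff_of_true (Functor.leftAdjointObjIsDefined_of_isColimit hc
    fun x => leftAdjointObjIsDefined_coyoneda F _ _) trivial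

theorem isEquivalence_comparison_restrict (F : C ⥤ D) [PreservesFiniteProducts F] [F.EssSurj]
    {L : (preservesFiniteProductsProperty.{u} C).FullSubcategory ⥤
      (preservesFiniteProductsProperty.{u} D).FullSubcategory} (adj : L ⊣ restrict F) :
    (Monad.comparison adj).IsEquivalence := by
  have : HasReflexiveCoequalizers (preservesFiniteProductsProperty.{u} D).FullSubcategory :=
    hasReflexiveCoequalizers_iff.1 inferInstance
  have := reflectsIsomorphisms_restrict F
  have : Monad.PreservesColimitOfIsReflexivePair (restrict F) :=
    ⟨fun A B f g _ => by
      have := preservesColimitsOfShape_restrict F WalkingReflexivePair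
      have : PreservesColimit
          (WalkingParallelPair.inclusionWalkingReflexivePair ⋙ ofIsReflexivePair f g)
          (restrict F) := inferInstance
      -- A reflexive coequalizer is the colimit of the whole reflexive diagram, so forgetting the
      -- common section loses nothing.
      exact preservesColimit_of_iso_diagram (restrict F)
        (inclusionWalkingReflexivePairOfIsReflexivePairIso f g)⟩
  exact (Monad.monadicOfHasPreservesReflexiveCoequalizersOfReflectsIsomorphisms adj).eqv

end Restriction


end CategoryTheory

namespace SecondOrder

theorem Theory.hasFiniteProducts (T : Theory.{u}) : HasFiniteProducts T.Cat := by
  have : HasTerminal T.Cat := T.terminal.some.hasTerminal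
  have (X Y : T.Cat) : HasLimit (pair X Y) := ⟨⟨_, (T.product ⟨X.ctx⟩ ⟨Y.ctx⟩).some⟩⟩
  have : HasBinaryProducts T.Cat := hasBinaryProducts_of_hasLimit_pair _
  exact hasFiniteProducts_of_has_binary_and_terminal

theorem Translation.essSurj {T T' : Theory.{u}} (F : Translation T T') : F.functor.EssSurj where
  mem_essImage X := ⟨⟨X.ctx⟩, ⟨eqToIso (Functor.congr_obj F.comm ⟨X.ctx⟩)⟩⟩

end SecondOrder

theorem theorem8p3 {T T' : SecondOrder.Theory.{u}} (F : SecondOrder.Translation T T') :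
    F.algebraicFunctor.IsRightAdjoint ∧
      ∀ (L : T.FMod ⥤ T'.FMod) (adj : L ⊣ F.algebraicFunctor),
        (Monad.comparison adj).IsEquivalence := by
  have := F.cartesian
  have := T.hasFiniteProducts
  have := F.essSurj
  exact ⟨isRightAdjoint_restrict F.functor,
    fun L adj => isEquivalence_comparison_restrict F.functor adj⟩
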